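/- Let $(M,g)$ be a smooth semi-Riemannian manifold (without boundary), let $u\in C^2(M)$ and $\varepsilon\in\{1,-1\}$, and equip $\bar M=M\times\mathbb{R}$ with the semi-Riemannian metric $\langle\cdot,\cdot\rangle=g+\varepsilon\,dt^2$. Let $F:M\to\bar M$, $F(x)=(x,u(x))$, be the graph map of $u$. Assume that $F$ is a semi-Riemannian hypersurface, i.e. that the induced form $\gamma=F^*\langle\cdot,\cdot\rangle$ is nondegenerate at every point, and that $\nu$ is its upward unit normal (that is, $\nu$ is orthogonal to $dF(TM)$ and $dt(\nu)>0$), with $\langle\nu,\nu\rangle=\varepsilon'$ on $M$ for a constant $\varepsilon'\in\{1,-1\}$. Let $\vec H=\mathrm{tr}_\gamma(II)$ be the mean curvature vector of $F$, where $II(X,Y)=(\bar\nabla_X\,dF(Y))^\perp$ is its second fundamental form, $\bar\nabla$ is the Levi-Civita connection of $\bar M$ and $\perp$ denotes the component normal to $F$. Let $\nabla u$ be the $g$-gradient of $u$, let $\mathrm{div}$ be the divergence $\mathrm{div}\,V=\mathrm{tr}(X\mapsto\nabla_X V)$ with respect to the Levi-Civita connection $\nabla$ of $g$, and put $|\nabla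 u|^2=g(\nabla u,\nabla u)$. Then $\varepsilon'(\varepsilon+|\nabla u|^2)>0$ on $M$ and, with $W=\sqrt{\varepsilon'(\varepsilon+|\nabla u|^2)}$, the map $F$ is a vertical translating soliton, i.e. $\vec H=\partial_t^{\perp}$ along $F$, if and only if $$\mathrm{div}\left(\frac{\nabla u}{W}\right)=\frac1W\quad\text{on } M .$$ -/

import Mathlib

open Set
open scoped Manifold ContDiff

noncomputable section

namespace SemiRiemann

section Geometry

variable {E : Type*} [NormedAddCommGroup E] [NormedSpace ℝ E]
  {H : Type*} [TopologicalSpace H] (I : ModelWithCorners ℝ E H)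
  {M : Type*} [TopologicalSpace M] [ChartedSpace H M]
  {E' : Type*} [NormedAddCommGroup E'] [NormedSpace ℝ E']
  {H' : Type*} [TopologicalSpace H'] (J : ModelWithCorners ℝ E' H')
  {N : Type*} [TopologicalSpace N] [ChartedSpace H' N]

/-- A field of bilinear forms on the tangent spaces of `M`. -/
abbrev FormField (M : Type*) [TopologicalSpace M] [ChartedSpace H M] :=
  ∀ x : M, TangentSpace I x →L[ℝ] TangentSpace I x →L[ℝ] ℝ

/-- `g` is a (smooth) semi-Riemannian metric: a smooth field of symmetric nondegenerate bilinear
forms. The index of `g` is then automatically locally constant, hence constant on each connected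
component of `M`; it is not required to be the same on different components. -/
structure IsSemiRiemannianMetric [IsManifold I ∞ M] (g : FormField I M) : Prop where
  symm : ∀ (x : M) (v w : TangentSpace I x), g x v w = g x w v
  nondegenerate : ∀ (x : M) (v : TangentSpace I x), (∀ w : TangentSpace I x, g x v w = 0) → v = 0
  smooth : ContMDiff I (I.prod 𝓘(ℝ, E →L[ℝ] E →L[ℝ] ℝ)) ∞
    (fun x ↦ Bundle.TotalSpace.mk' (E →L[ℝ] E →L[ℝ] ℝ)
      (E := fun x : M ↦ TangentSpace I x →L[ℝ] TangentSpace I x →L[ℝ] ℝ) x (g x))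

/-- The pullback `F^*h` of a field of bilinear forms under `F : M → N`:
`(F^*h)(v, w) = h(dF v, dF w)`. -/
def pullback (h : FormField J N) (F : M → N) : FormField I M := fun x ↦
  (ContinuousLinearMap.precomp ℝ (mfderiv I J F x)) ∘L (h (F x)) ∘L (mfderiv I J F x)

/-- The coordinate expression of the metric `g` in the preferred chart `φ` at `x₀`: at the point
`y` of the chart, this is the pullback of `g` under `φ⁻¹`. -/
def localMetric (g : FormField I M) (x₀ : M) (y : E) : E →L[ℝ] E →L[ℝ] ℝ :=
  let A := mfderivWithin 𝓘(ℝ, E) I (extChartAt I x₀).symm (range I) y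
  (ContinuousLinearMap.precomp ℝ A) ∘L (g ((extChartAt I x₀).symm y)) ∘L A

/-- The Christoffel symbols of the Levi-Civita connection of `g` at the point `x₀`, in the
preferred chart at `x₀`. With `G` the coordinate expression of `g`, the vector `Γ(v, w)` is
determined by
`G(Γ(v, w), z) = ½ (∂_v G(w, z) + ∂_w G(v, z) - ∂_z G(v, w))` for all `z`
(`inverse` inverts the map `v ↦ G(v, ·)` from vectors to covectors, i.e. it raises the index). -/
def christoffel (g : FormField I M) (x₀ : M) (v w : E) : E :=
  let G : E → E →L[ℝ] E →L[ℝ] ℝ := localMetric I g x₀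
  let y₀ : E := extChartAt I x₀ x₀
  (G y₀).inverse ((1 / 2 : ℝ) •
    (fderivWithin ℝ (fun y ↦ G y w) (range I) y₀ v + fderivWithin ℝ (fun y ↦ G y v) (range I) y₀ w
      - fderivWithin ℝ (fun y ↦ G y v w) (range I) y₀))

/-- The Levi-Civita covariant derivative `∇_v V` of a vector field `V` along a map `F : M → N`, in
the direction `v ∈ T_{x₀}M`, with respect to the metric `h` of `N`. If `V^k` are the components of
`V` in the preferred chart `ψ` of `N` at `F x₀`, then the components of `∇_v V` are
`v(V^k) + Γ^k_{ij} (dF v)^i V^j`. -/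
def covDerivAlong (h : FormField J N) (F : M → N) (V : ∀ x : M, TangentSpace J (F x))
    (x₀ : M) (v : TangentSpace I x₀) : TangentSpace J (F x₀) :=
  let ψ : N → E' := extChartAt J (F x₀)
  let Vloc : M → E' := fun x ↦ mfderiv J 𝓘(ℝ, E') ψ (F x) (V x)
  let dFv : E' := mfderiv J 𝓘(ℝ, E') ψ (F x₀) (mfderiv I J F x₀ v)
  (mfderiv J 𝓘(ℝ, E') ψ (F x₀)).inverse
    (mvfderiv I Vloc x₀ v + christoffel J h (F x₀) dFv (Vloc x₀))

/-- The Levi-Civita covariant derivative `∇_v V` of a vector field `V` on `(M, g)`. -/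
def covDeriv (g : FormField I M) (V : ∀ x : M, TangentSpace I x) (x₀ : M)
    (v : TangentSpace I x₀) : TangentSpace I x₀ :=
  covDerivAlong I I g id V x₀ v

/-- A basis of the tangent space `T_xM`. -/
def tangentBasis [FiniteDimensional ℝ E] (x : M) :
    Module.Basis (Fin (Module.finrank ℝ E)) ℝ (TangentSpace I x) :=
  Module.finBasis ℝ E

/-- The divergence `div V = tr(v ↦ ∇_v V)` of a vector field `V` on `(M, g)`. -/
def divergence [FiniteDimensional ℝ E] (g : FormField I M) (V : ∀ x : M, TangentSpace I x)
    (x : M) : ℝ :=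
  ∑ i, (tangentBasis I x).coord i (covDeriv I g V x (tangentBasis I x i))

/-- The gradient of a function `u` on `(M, g)`: `g(∇u, ·) = du`. -/
def gradient (g : FormField I M) (u : M → ℝ) (x : M) : TangentSpace I x :=
  (g x).inverse (mvfderiv I u x)

/-- `F : M → (N, h)` is a (twice continuously differentiable) immersed semi-Riemannian submanifold:
the induced bilinear form `F^*h` is nondegenerate at every point. In particular `dF` is injective
at every point. -/
structure IsSemiRiemannianImmersion (h : FormField J N) (F : M → N) : Prop where
  contMDiff : ContMDiff I J 2 F
  nondegenerate : ∀ (x : M) (v : TangentSpace I x),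
    (∀ w : TangentSpace I x, pullback I J h F x v w = 0) → v = 0

/-- The normal component `ξ^⊥ = ξ - dF(ξ^⊤)` of `ξ ∈ T_{F x}N`, where the tangential component
`dF(ξ^⊤)` is given by `h(dF(ξ^⊤), dF w) = h(ξ, dF w)` for all `w ∈ T_xM`. -/
def normalPart (h : FormField J N) (F : M → N) (x : M) (ξ : TangentSpace J (F x)) :
    TangentSpace J (F x) :=
  ξ - mfderiv I J F x ((pullback I J h F x).inverse ((h (F x) ξ) ∘L (mfderiv I J F x)))

/-- The second fundamental form `II(v, w) = (∇_v dF(W))^⊥` of `F : M → (N, h)` at `x₀`, where `∇` is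
the Levi-Civita connection of `(N, h)` and `W` is the vector field with `W x₀ = w` that has constant
components in the preferred chart of `M` at `x₀`. -/
def secondFundamentalForm [IsManifold I 1 M] (h : FormField J N) (F : M → N) (x₀ : M)
    (v w : TangentSpace I x₀) : TangentSpace J (F x₀) :=
  let W : ∀ x : M, TangentSpace I x := FiberBundle.extend E w
  normalPart I J h F x₀ (covDerivAlong I J h F (fun x ↦ mfderiv I J F x (W x)) x₀ v)

/-- The mean curvature vector `tr_γ(II) = ∑ γ^{ij} II(e_i, e_j)` of `F : M → (N, h)`, the trace being
taken with respect to the induced metric `γ = F^*h` (and not divided by the dimension). -/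
def meanCurvatureVector [FiniteDimensional ℝ E] [IsManifold I 1 M] (h : FormField J N) (F : M → N)
    (x : M) : TangentSpace J (F x) :=
  let e := tangentBasis I x
  let γ : Matrix (Fin (Module.finrank ℝ E)) (Fin (Module.finrank ℝ E)) ℝ :=
    Matrix.of fun i j ↦ pullback I J h F x (e i) (e j)
  ∑ i, ∑ j, γ⁻¹ i j • secondFundamentalForm I J h F x (e i) (e j)

end Geometry

section Product

variable {E : Type*} [NormedAddCommGroup E] [NormedSpace ℝ E]
  {H : Type*} [TopologicalSpace H] (I : ModelWithCorners ℝ E H)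
  {M : Type*} [TopologicalSpace M] [ChartedSpace H M]
  {E' : Type*} [NormedAddCommGroup E'] [NormedSpace ℝ E']
  {H' : Type*} [TopologicalSpace H'] (J : ModelWithCorners ℝ E' H')
  {N : Type*} [TopologicalSpace N] [ChartedSpace H' N]

/-- The differential `dt` of the projection `M × ℝ → ℝ`. -/
def dt (p : M × ℝ) : TangentSpace (I.prod 𝓘(ℝ, ℝ)) p →L[ℝ] ℝ :=
  mvfderiv (I.prod 𝓘(ℝ, ℝ)) (Prod.snd : M × ℝ → ℝ) p

/-- The vector field `∂_t` on `M × ℝ`: the velocity of the vertical lines `t ↦ (x, t)`. -/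
def partialT (p : M × ℝ) : TangentSpace (I.prod 𝓘(ℝ, ℝ)) p :=
  mfderiv 𝓘(ℝ, ℝ) (I.prod 𝓘(ℝ, ℝ)) (fun t : ℝ ↦ (p.1, t)) p.2 (1 : ℝ)

/-- The metric `g + ε dt²` on `M × ℝ`. -/
def productMetric (g : FormField I M) (ε : ℝ) : FormField (I.prod 𝓘(ℝ, ℝ)) (M × ℝ) := fun p ↦
  pullback (I.prod 𝓘(ℝ, ℝ)) I g (Prod.fst : M × ℝ → M) p + ε • (dt I p).smulRight (dt I p)

/-- A semi-Riemannian submanifold `F : N → M × ℝ` of `(M × ℝ, h)` is a (vertical) translating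
soliton of the mean curvature flow if its mean curvature vector is the normal component of `∂_t`. -/
structure IsTranslatingSoliton [FiniteDimensional ℝ E'] [IsManifold J 1 N]
    (h : FormField (I.prod 𝓘(ℝ, ℝ)) (M × ℝ)) (F : N → M × ℝ) : Prop where
  isSemiRiemannianImmersion : IsSemiRiemannianImmersion J (I.prod 𝓘(ℝ, ℝ)) h F
  meanCurvatureVector_eq : ∀ x : N, meanCurvatureVector J (I.prod 𝓘(ℝ, ℝ)) h F x =
    normalPart J (I.prod 𝓘(ℝ, ℝ)) h F x (partialT I (F x))

/-- The graph map `F x = (x, u x)`. -/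
def graphMap (u : M → ℝ) (x : M) : M × ℝ := (x, u x)

/-- `ν` is the upward unit normal along the hypersurface `F : N → (M × ℝ, h)`, with causal sign
`ε'`: it is orthogonal to the hypersurface, `h(ν, ν) = ε'`, and its `∂_t`-component is positive. -/
structure IsUpwardUnitNormal (h : FormField (I.prod 𝓘(ℝ, ℝ)) (M × ℝ)) (F : N → M × ℝ) (ε' : ℝ)
    (ν : ∀ x : N, TangentSpace (I.prod 𝓘(ℝ, ℝ)) (F x)) : Prop where
  orthogonal : ∀ (x : N) (w : TangentSpace J x), h (F x) (ν x)
    (mfderiv J (I.prod 𝓘(ℝ, ℝ)) F x w) = 0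
  unit : ∀ x : N, h (F x) (ν x) (ν x) = ε'
  upward : ∀ x : N, 0 < dt I (F x) (ν x)

/-- The function `W = √(ε' (ε + |∇u|²))`, where `|∇u|² = g(∇u, ∇u)`. -/
def graphW (g : FormField I M) (ε ε' : ℝ) (u : M → ℝ) (x : M) : ℝ :=
  √(ε' * (ε + g x (gradient I g u x) (gradient I g u x)))

end Product

end SemiRiemann

end

/-!
Everything is computed at a point `x₀`, in the preferred chart of `M` at `x₀`, which is also the chart
in which the definitions of the Christoffel symbols and of the covariant derivative are written.
The differential of this chart at `x₀` is the identity of the model space `E`, so that tangent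
vectors at `x₀` are their own components. Let `G` be the coordinate expression of `g`, `Γ` its
Christoffel symbols, and `Hess u(v, w) = ∂²u(v, w) - du(Γ(v, w))`.

*The mean curvature of a graph.* The Christoffel symbols of `g + ε dt²` are those of `g`, with
vanishing `t`-component (`coordChristoffel_prod`), so the covariant derivative of the coordinate
field `dF(∂_w)` in the direction `v` is `(Γ(v, w), ∂²u(v, w)) = dF(Γ(v, w)) + Hess u(v, w) ∂_t`
(`covDerivAlong_graphMap`). The first summand is tangential; hence `II = Hess u ⊗ ∂_t^⊥` and
`H = tr_γ(Hess u) ∂_t^⊥`, where `γ = g + ε du²`.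

*The divergence.* Since `g(∇_v ∇u, z) = Hess u(v, z)` (`apply_covDeriv_coordGradient`), the derivative
of `|∇u|²` along `v` is `2 Hess u(v, ∇u)`, and therefore `∇_v(∇u / W) = T v / W` with
`T v = ∇_v ∇u - Hess u(v, ∇u) / (ε + |∇u|²) ∇u`. As `ε² = 1`, the endomorphism `T` satisfies
`γ(T v, z) = Hess u(v, z)` (`apply_trace_endomorphism`), so its trace is `tr_γ(Hess u)`
(`sum_inv_gram_eq_trace`). This gives `H = W div(∇u / W) ∂_t^⊥` (`meanCurvatureVector_graphMap`).

*Conclusion.* Orthogonality forces `ν = dt(ν) (-ε ∇u, 1)`, whence `ε' = dt(ν)² (ε + |∇u|²)`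
(`normal_sign_eq`), which proves the positivity claim and `W > 0`. Finally `∂_t^⊥ ≠ 0` because
`⟨ν, ∂_t⟩ = ε dt(ν) ≠ 0`, so `H = ∂_t^⊥` is equivalent to `W div(∇u / W) = 1`.

The tangent spaces of `M` and `M × ℝ` are by definition the model spaces `E` and `E × ℝ`; vectors and
forms are freely moved across this identification, by type ascriptions and by terms that
hold up to unfolding it.
-/

namespace SemiRiemann

open Filter Topology

/-! ### Nondegenerate bilinear forms -/

section LinearAlgebra

variable {E : Type*} [NormedAddCommGroup E] [NormedSpace ℝ E] [FiniteDimensional ℝ E]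

lemma isInvertible_of_nondegenerate {B : E →L[ℝ] E →L[ℝ] ℝ}
    (hB : ∀ v, (∀ w, B v w = 0) → v = 0) : B.IsInvertible := by
  have hinj : Function.Injective B.toLinearMap := by
    rw [injective_iff_map_eq_zero]
    intro v hv
    exact hB v fun w ↦ by simpa using congrArg (fun f : E →L[ℝ] ℝ ↦ f w) hv
  have hdim : Module.finrank ℝ E = Module.finrank ℝ (E →L[ℝ] ℝ) := by
    rw [← (LinearMap.toContinuousLinearMap (𝕜 := ℝ) (E := E) (F' := ℝ)).finrank_eq]
    exact (Subspace.dual_finrank_eq (K := ℝ) (V := E)).symm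
  exact ⟨(LinearEquiv.ofInjectiveOfFinrankEq B.toLinearMap hinj hdim).toContinuousLinearEquiv,
    by ext; rfl⟩

omit [FiniteDimensional ℝ E] in
lemma apply_inverse_self {B : E →L[ℝ] E →L[ℝ] ℝ} (hB : B.IsInvertible) (η : E →L[ℝ] ℝ) :
    B (B.inverse η) = η := by
  simpa using congrArg (fun f : (E →L[ℝ] ℝ) →L[ℝ] (E →L[ℝ] ℝ) ↦ f η) hB.self_comp_inverse

omit [FiniteDimensional ℝ E] in
/-- The trace of a bilinear form `b` with respect to a nondegenerate symmetric form `γ` is the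
trace of the endomorphism `T` with `γ(T v, w) = b(v, w)`. -/
lemma sum_inv_gram_eq_trace {ι : Type*} [Fintype ι] [DecidableEq ι]
    (e : Module.Basis ι ℝ E) {γ : E →L[ℝ] E →L[ℝ] ℝ} (hsymm : ∀ v w, γ v w = γ w v)
    (hγ : ∀ v, (∀ w, γ v w = 0) → v = 0) {b : E → E → ℝ} {T : E → E}
    (hT : ∀ v w, γ (T v) w = b v w) :
    ∑ i, ∑ j, (Matrix.of fun i j ↦ γ (e i) (e j))⁻¹ i j * b (e i) (e j) =
      ∑ i, e.coord i (T (e i)) := by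
  set A : Matrix ι ι ℝ := Matrix.of fun i j ↦ γ (e i) (e j) with hA
  have hdet : IsUnit A.det := by
    rw [isUnit_iff_ne_zero]
    intro h0
    -- A vector in the kernel of the Gram matrix is a vector in the radical of `γ`.
    obtain ⟨c, hc, hc0⟩ := Matrix.exists_vecMul_eq_zero_iff.mpr h0
    refine hc ?_
    have h1 : ∑ i, c i • e i = 0 := by
      refine hγ _ fun w ↦ ?_
      have h2 : (γ (∑ i, c i • e i)).toLinearMap = 0 := by
        refine e.ext fun j ↦ ?_
        have := congrFun hc0 j
        simpa [Matrix.vecMul, dotProduct, hA] using this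
      exact congrArg (fun f : E →ₗ[ℝ] ℝ ↦ f w) h2
    exact funext (Fintype.linearIndependent_iff.mp e.linearIndependent c h1)
  have hb : ∀ i j, b (e i) (e j) = ∑ k, e.coord k (T (e i)) * A k j := by
    intro i j
    rw [← hT]
    conv_lhs => rw [← e.sum_repr (T (e i))]
    simp only [map_sum, map_smul, sum_apply, smul_apply, smul_eq_mul, hA, Matrix.of_apply,
      Module.Basis.coord_apply]
  have key : ∀ i, ∑ j, A⁻¹ i j * b (e i) (e j) = e.coord i (T (e i)) := by
    intro i
    have hmul : ∀ k, ∑ j, A⁻¹ i j * A k j = if i = k then 1 else 0 := by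
      intro k
      have h3 : (A⁻¹ * A) i k = (1 : Matrix ι ι ℝ) i k := by rw [Matrix.nonsing_inv_mul A hdet]
      rw [Matrix.mul_apply, Matrix.one_apply] at h3
      rw [← h3]
      exact Finset.sum_congr rfl fun j _ ↦ by rw [hA]; simp [hsymm (e k) (e j)]
    simp_rw [hb, Finset.mul_sum]
    rw [Finset.sum_comm]
    calc ∑ k, ∑ j, A⁻¹ i j * (e.coord k (T (e i)) * A k j)
        = ∑ k, e.coord k (T (e i)) * ∑ j, A⁻¹ i j * A k j := by
          refine Finset.sum_congr rfl fun k _ ↦ ?_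
          rw [Finset.mul_sum]
          exact Finset.sum_congr rfl fun j _ ↦ by ring
      _ = e.coord i (T (e i)) := by simp [hmul]
  exact Finset.sum_congr rfl fun i _ ↦ key i

end LinearAlgebra

/-! ### Christoffel symbols, Hessian and gradient on a vector space -/

section LocalCalculus

variable {E : Type*} [NormedAddCommGroup E] [NormedSpace ℝ E]

/-- The Christoffel symbols at `y` of a field `G` of bilinear forms on a vector space, the index
being raised by the inverse of `v ↦ G(v, ·)`. -/
noncomputable def coordChristoffel (G : E → E →L[ℝ] E →L[ℝ] ℝ) (y v w : E) : E :=
  (G y).inverse ((1 / 2 : ℝ) •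
    (fderiv ℝ (fun y ↦ G y w) y v + fderiv ℝ (fun y ↦ G y v) y w
      - fderiv ℝ (fun y ↦ G y v w) y))

/-- The Hessian `∂²f(v, w) - df(Γ(v, w))` of `f` at `y` with respect to the field `G` of bilinear
forms. -/
noncomputable def coordHessian (G : E → E →L[ℝ] E →L[ℝ] ℝ) (f : E → ℝ) (y v w : E) : ℝ :=
  fderiv ℝ (fderiv ℝ f) y v w - fderiv ℝ f y (coordChristoffel G y v w)

lemma fderiv_apply_const {G : E → E →L[ℝ] E →L[ℝ] ℝ} {y : E} (hG : DifferentiableAt ℝ G y)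
    (v w : E) : fderiv ℝ (fun y ↦ G y w) y v = fderiv ℝ G y v w := by
  have := hG.hasFDerivAt.clm_apply (hasFDerivAt_const w y)
  rw [this.fderiv]
  simp

lemma fderiv_apply_const₂ {G : E → E →L[ℝ] E →L[ℝ] ℝ} {y : E} (hG : DifferentiableAt ℝ G y)
    (v w z : E) : fderiv ℝ (fun y ↦ G y v w) y z = fderiv ℝ G y z v w := by
  have := (hG.hasFDerivAt.clm_apply (hasFDerivAt_const v y)).clm_apply (hasFDerivAt_const w y)
  rw [this.fderiv]
  simp

lemma apply_coordChristoffel {G : E → E →L[ℝ] E →L[ℝ] ℝ} {y : E} (hG : DifferentiableAt ℝ G y)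
    (hinv : (G y).IsInvertible) (v w z : E) :
    G y (coordChristoffel G y v w) z =
      (1 / 2) * (fderiv ℝ G y v w z + fderiv ℝ G y w v z - fderiv ℝ G y z v w) := by
  rw [coordChristoffel, apply_inverse_self hinv]
  simp [fderiv_apply_const hG, fderiv_apply_const₂ hG]

lemma fderiv_symm {G : E → E →L[ℝ] E →L[ℝ] ℝ} {y : E} (hG : DifferentiableAt ℝ G y)
    (hsymm : ∀ᶠ y' in 𝓝 y, ∀ v w, G y' v w = G y' w v) (z v w : E) :
    fderiv ℝ G y z v w = fderiv ℝ G y z w v := by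
  rw [← fderiv_apply_const₂ hG, ← fderiv_apply_const₂ hG]
  have : (fun y' ↦ G y' v w) =ᶠ[𝓝 y] fun y' ↦ G y' w v := hsymm.mono fun y' h ↦ h v w
  rw [this.fderiv_eq]

variable {G : E → E →L[ℝ] E →L[ℝ] ℝ} {f : E → ℝ} {Z : E → E} {y : E}

lemma coordChristoffel_smul_right (hG : DifferentiableAt ℝ G y) (hinv : (G y).IsInvertible)
    (c : ℝ) (v w : E) : coordChristoffel G y v (c • w) = c • coordChristoffel G y v w := by
  refine hinv.injective ?_
  ext z
  simp only [apply_coordChristoffel hG hinv, map_smul, smul_apply, smul_eq_mul]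
  ring

variable [FiniteDimensional ℝ E]

/-- The coordinate gradient of a `C²` function is differentiable. -/
lemma differentiableAt_coordGradient (hG : DifferentiableAt ℝ G y) (hinv : (G y).IsInvertible)
    (hf : ContDiffAt ℝ 2 f y) (hZ : ∀ᶠ y' in 𝓝 y, G y' (Z y') = fderiv ℝ f y') :
    DifferentiableAt ℝ Z y := by
  obtain ⟨e, he⟩ := hinv
  -- Near `y` the gradient is `G⁻¹ df`, and inversion is smooth at invertible maps.
  have h1 : DifferentiableAt ℝ (fun y' ↦ (G y').inverse) y := by
    have h2 := (contDiffAt_map_inverse (n := 1) e).differentiableAt one_ne_zero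
    rw [he] at h2
    exact h2.comp y hG
  have h3 : DifferentiableAt ℝ (fderiv ℝ f) y :=
    (hf.fderiv_right (m := 1) (by norm_num)).differentiableAt one_ne_zero
  refine (h1.clm_apply h3).congr_of_eventuallyEq ?_
  have hopen : ∀ᶠ y' in 𝓝 y, (G y').IsInvertible := by
    have h4 : range ((↑) : (E ≃L[ℝ] (E →L[ℝ] ℝ)) → E →L[ℝ] (E →L[ℝ] ℝ)) ∈ 𝓝 (G y) := by
      rw [← he]; exact ContinuousLinearEquiv.nhds e
    exact hG.continuousAt h4
  filter_upwards [hZ, hopen] with y' h5 h6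
  rw [← h5, h6.inverse_apply_self]

/-- `g(∇_v ∇f, z) = Hess f(v, z)` in coordinates. -/
lemma apply_covDeriv_coordGradient (hG : DifferentiableAt ℝ G y) (hinv : (G y).IsInvertible)
    (hsymm : ∀ᶠ y' in 𝓝 y, ∀ v w, G y' v w = G y' w v)
    (hf : ContDiffAt ℝ 2 f y) (hZ : ∀ᶠ y' in 𝓝 y, G y' (Z y') = fderiv ℝ f y') (v z : E) :
    G y (fderiv ℝ Z y v + coordChristoffel G y v (Z y)) z = coordHessian G f y v z := by
  have hZd := differentiableAt_coordGradient hG hinv hf hZ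
  have h3 : DifferentiableAt ℝ (fderiv ℝ f) y :=
    (hf.fderiv_right (m := 1) (by norm_num)).differentiableAt one_ne_zero
  have h4 : fderiv ℝ (fderiv ℝ f) y v z = fderiv ℝ G y v (Z y) z + G y (fderiv ℝ Z y v) z := by
    have hZ' : fderiv ℝ f =ᶠ[𝓝 y] fun y' ↦ G y' (Z y') := hZ.mono fun _ h ↦ h.symm
    rw [hZ'.fderiv_eq, (hG.hasFDerivAt.clm_apply hZd.hasFDerivAt).fderiv]
    simp [add_comm]
  have h5 : fderiv ℝ f y (coordChristoffel G y v z) = G y (coordChristoffel G y v z) (Z y) := by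
    rw [← hZ.self_of_nhds]
    exact hsymm.self_of_nhds _ _
  rw [coordHessian, h5, map_add, add_apply, apply_coordChristoffel hG hinv,
    apply_coordChristoffel hG hinv, h4, fderiv_symm hG hsymm v (Z y) z]
  rw [fderiv_symm hG hsymm (Z y) v z]
  ring

/-- `d|∇f|²(v) = 2 Hess f(v, ∇f)` in coordinates. -/
lemma hasFDerivAt_normSq_coordGradient (hG : DifferentiableAt ℝ G y) (hinv : (G y).IsInvertible)
    (hsymm : ∀ᶠ y' in 𝓝 y, ∀ v w, G y' v w = G y' w v)
    (hf : ContDiffAt ℝ 2 f y) (hZ : ∀ᶠ y' in 𝓝 y, G y' (Z y') = fderiv ℝ f y') :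
    ∃ L : E →L[ℝ] ℝ, HasFDerivAt (fun y' ↦ G y' (Z y') (Z y')) L y ∧
      ∀ v, L v = 2 * coordHessian G f y v (Z y) := by
  have hZd := differentiableAt_coordGradient hG hinv hf hZ
  refine ⟨_, (hG.hasFDerivAt.clm_apply hZd.hasFDerivAt).clm_apply hZd.hasFDerivAt, fun v ↦ ?_⟩
  rw [← apply_covDeriv_coordGradient hG hinv hsymm hf hZ, map_add]
  simp only [add_apply, ContinuousLinearMap.comp_apply, ContinuousLinearMap.flip_apply,
    hsymm.self_of_nhds (Z y) (fderiv ℝ Z y v), apply_coordChristoffel hG hinv,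
    fderiv_symm hG hsymm (Z y) v (Z y)]
  ring

/-- The covariant derivative of `∇f / W`, where `W = √(ε' (ε + |∇f|²))`, in coordinates. -/
lemma covDeriv_normalized_coordGradient (hG : DifferentiableAt ℝ G y) (hinv : (G y).IsInvertible)
    (hsymm : ∀ᶠ y' in 𝓝 y, ∀ v w, G y' v w = G y' w v)
    (hf : ContDiffAt ℝ 2 f y) (hZ : ∀ᶠ y' in 𝓝 y, G y' (Z y') = fderiv ℝ f y')
    {ε ε' : ℝ} (hpos : 0 < ε' * (ε + G y (Z y) (Z y))) :
    DifferentiableAt ℝ (fun y' ↦ (1 / √(ε' * (ε + G y' (Z y') (Z y')))) • Z y') y ∧ ∀ v,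
    fderiv ℝ (fun y' ↦ (1 / √(ε' * (ε + G y' (Z y') (Z y')))) • Z y') y v +
      coordChristoffel G y v ((1 / √(ε' * (ε + G y (Z y) (Z y)))) • Z y) =
    (1 / √(ε' * (ε + G y (Z y) (Z y)))) • (fderiv ℝ Z y v + coordChristoffel G y v (Z y) -
      (coordHessian G f y v (Z y) / (ε + G y (Z y) (Z y))) • Z y) := by
  have hZd := differentiableAt_coordGradient hG hinv hf hZ
  obtain ⟨L, hL, hLv⟩ := hasFDerivAt_normSq_coordGradient hG hinv hsymm hf hZ
  set q : ℝ := G y (Z y) (Z y) with hq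
  set W : ℝ := √(ε' * (ε + q)) with hW
  have hW0 : 0 < W := Real.sqrt_pos.mpr hpos
  have hW2 : W ^ 2 = ε' * (ε + q) := Real.sq_sqrt hpos.le
  have hε' : ε' ≠ 0 := by rintro rfl; simp at hpos
  have hεq : ε + q ≠ 0 := by intro h; simp [h] at hpos
  have hsqrt : HasFDerivAt (fun y' ↦ √(ε' * (ε + G y' (Z y') (Z y'))))
      ((1 / (2 * W)) • (ε' • L)) y :=
    ((hL.const_add ε).const_mul ε').sqrt hpos.ne'
  have hV := ((hasDerivAt_inv hW0.ne').comp_hasFDerivAt y hsqrt).smul hZd.hasFDerivAt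
  have hfun : (fun y' ↦ (1 / √(ε' * (ε + G y' (Z y') (Z y')))) • Z y') =
      ((fun x : ℝ ↦ x⁻¹) ∘ fun y' ↦ √(ε' * (ε + G y' (Z y') (Z y')))) • Z := by
    ext y'; simp
  rw [hfun]
  refine ⟨hV.differentiableAt, fun v ↦ ?_⟩
  rw [hV.fderiv, coordChristoffel_smul_right hG hinv]
  have hc : W⁻¹ * (coordHessian G f y v (Z y) / (ε + q)) =
      (W ^ 2)⁻¹ * (1 / (2 * W) * (ε' * L v)) := by
    rw [hLv, hW2]
    field_simp
  simp only [one_div, Function.comp_apply, add_apply, smul_apply, smul_eq_mul, smul_sub, smul_add,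
    smul_smul, hc, ContinuousLinearMap.smulRight_apply, ← hq, ← hW]
  module

/-- The endomorphism `v ↦ ∇_v ∇f - Hess f(v, ∇f) / (ε + |∇f|²) ∇f` represents the Hessian of `f` with
respect to the form `g + ε df²`. -/
lemma apply_trace_endomorphism (hG : DifferentiableAt ℝ G y) (hinv : (G y).IsInvertible)
    (hsymm : ∀ᶠ y' in 𝓝 y, ∀ v w, G y' v w = G y' w v)
    (hf : ContDiffAt ℝ 2 f y) (hZ : ∀ᶠ y' in 𝓝 y, G y' (Z y') = fderiv ℝ f y')
    {ε : ℝ} (hε : ε = 1 ∨ ε = -1) (hne : ε + G y (Z y) (Z y) ≠ 0) (v z : E) {X : E}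
    (hX : X = fderiv ℝ Z y v + coordChristoffel G y v (Z y) -
      (coordHessian G f y v (Z y) / (ε + G y (Z y) (Z y))) • Z y) :
    G y X z + ε * (fderiv ℝ f y X * fderiv ℝ f y z) = coordHessian G f y v z := by
  have hS := apply_covDeriv_coordGradient hG hinv hsymm hf hZ v
  set S := fderiv ℝ Z y v + coordChristoffel G y v (Z y)
  have hdf : ∀ w, fderiv ℝ f y w = G y (Z y) w := fun w ↦ by rw [← hZ.self_of_nhds]
  have hε2 : ε ^ 2 = 1 := by rcases hε with rfl | rfl <;> norm_num
  rw [hdf, hdf, hX, map_sub, map_sub, map_smul, map_smul, sub_apply, smul_apply, smul_eq_mul,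
    smul_eq_mul, hS, hsymm.self_of_nhds (Z y) S, hS]
  set h := coordHessian G f y v (Z y)
  set q := G y (Z y) (Z y)
  have : h - h / (ε + q) * q = ε * (h / (ε + q)) := by field_simp; ring
  rw [this]
  linear_combination (h / (ε + q) * G y (Z y) z) * hε2

end LocalCalculus

/-! ### Metrics and vector fields in charts -/

section Charts

variable {E : Type*} [NormedAddCommGroup E] [NormedSpace ℝ E]
  {H : Type*} [TopologicalSpace H] {I : ModelWithCorners ℝ E H} [I.Boundaryless]
  {M : Type*} [TopologicalSpace M] [ChartedSpace H M]
  {F : Type*} [NormedAddCommGroup F] [NormedSpace ℝ F]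

/-- The derivative of a vector-valued map at `x₀` is computed in the preferred chart at `x₀`. -/
lemma mvfderiv_eq_fderiv_chart {f : M → F} {x₀ : M}
    (h : DifferentiableAt ℝ (f ∘ (extChartAt I x₀).symm) (extChartAt I x₀ x₀))
    (v : TangentSpace I x₀) :
    mvfderiv I f x₀ v =
      fderiv ℝ (f ∘ (extChartAt I x₀).symm) (extChartAt I x₀ x₀) v := by
  have hcont : ContinuousAt f x₀ := by
    have h1 : ContinuousAt ((f ∘ (extChartAt I x₀).symm) ∘ extChartAt I x₀) x₀ :=
      h.continuousAt.comp (continuousAt_extChartAt x₀)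
    refine h1.congr ?_
    filter_upwards [extChartAt_source_mem_nhds (I := I) x₀] with x hx
    exact congrArg f ((extChartAt I x₀).left_inv hx)
  have hd : MDifferentiableAt I 𝓘(ℝ, F) f x₀ := by
    rw [mdifferentiableAt_iff]
    exact ⟨hcont, h.differentiableWithinAt⟩
  rw [hd.mvfderiv, I.range_eq_univ, fderivWithin_univ]
  rfl

lemma differentiableAt_chart {f : M → F} {x₀ : M} (h : MDifferentiableAt I 𝓘(ℝ, F) f x₀) :
    DifferentiableAt ℝ (f ∘ (extChartAt I x₀).symm) (extChartAt I x₀ x₀) := by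
  have := ((mdifferentiableAt_iff _ _).mp h).2
  rw [I.range_eq_univ, differentiableWithinAt_univ] at this
  exact this

lemma contDiffAt_chart {f : M → F} {x₀ : M} {n : WithTop ℕ∞} (h : ContMDiffAt I 𝓘(ℝ, F) n f x₀) :
    ContDiffAt ℝ n (f ∘ (extChartAt I x₀).symm) (extChartAt I x₀ x₀) := by
  have := (contMDiffAt_iff.mp h).2
  rw [I.range_eq_univ, contDiffWithinAt_univ] at this
  exact this

/-- A family of continuous linear maps on a finite-dimensional space is differentiable if all its
evaluations are. -/
lemma differentiableAt_clm {D : Type*} [NormedAddCommGroup D] [NormedSpace ℝ D]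
    {E₁ : Type*} [NormedAddCommGroup E₁] [NormedSpace ℝ E₁] [FiniteDimensional ℝ E₁]
    {f : D → E₁ →L[ℝ] F} {y : D}
    (h : ∀ v, DifferentiableAt ℝ (fun x ↦ f x v) y) : DifferentiableAt ℝ f y := by
  let e₁ := ContinuousLinearEquiv.ofFinrankEq
    (Module.finrank_fin_fun ℝ (n := Module.finrank ℝ E₁)).symm
  let e₂ := (e₁.arrowCongr (1 : F ≃L[ℝ] F)).trans
    (ContinuousLinearEquiv.piRing (Fin (Module.finrank ℝ E₁)))
  rw [← Function.id_comp f, ← e₂.symm_comp_self]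
  exact e₂.symm.differentiableAt.comp y (differentiableAt_pi.mpr fun i ↦ h _)

lemma mdifferentiableAt_extChartAt_symm [IsManifold I 1 M] {x₀ : M} {y : E}
    (hy : y ∈ (extChartAt I x₀).target) :
    MDifferentiableAt 𝓘(ℝ, E) I (extChartAt I x₀).symm y := by
  have := mdifferentiableWithinAt_extChartAt_symm (I := I) hy
  rwa [I.range_eq_univ, mdifferentiableWithinAt_univ] at this

lemma fderiv_comp_extChartAt_symm [IsManifold I 1 M] {x₀ : M} {y : E}
    (hy : y ∈ (extChartAt I x₀).target) {f : M → F}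
    (hf : MDifferentiableAt I 𝓘(ℝ, F) f ((extChartAt I x₀).symm y)) (w : E) :
    fderiv ℝ (f ∘ (extChartAt I x₀).symm) y w =
      mvfderiv I f ((extChartAt I x₀).symm y)
        (mfderivWithin 𝓘(ℝ, E) I (extChartAt I x₀).symm (range I) y w) := by
  rw [← mfderiv_eq_fderiv, mfderiv_comp y hf (mdifferentiableAt_extChartAt_symm hy),
    I.range_eq_univ, mfderivWithin_univ]
  rfl

omit [I.Boundaryless] in
/-- `FiberBundle.extend` is the extension of `w ∈ T_{x₀}M` with constant components `w` in the chart
at `x₀`. -/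
lemma extend_extChartAt_symm [IsManifold I 1 M] {x₀ : M} {y : E}
    (hy : y ∈ (extChartAt I x₀).target) (w : TangentSpace I x₀) :
    (FiberBundle.extend E w ((extChartAt I x₀).symm y) :
        TangentSpace I ((extChartAt I x₀).symm y)) =
      mfderivWithin 𝓘(ℝ, E) I (extChartAt I x₀).symm (range I) y w := by
  have hs : (extChartAt I x₀).symm y ∈ (chartAt H x₀).source := by
    rw [← extChartAt_source (I := I)]; exact (extChartAt I x₀).map_target hy
  have h1 := TangentBundle.symmL_trivializationAt (I := I) (𝕜 := ℝ) hs
  rw [(extChartAt I x₀).right_inv hy] at h1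
  have hb : (extChartAt I x₀).symm y ∈ (trivializationAt E (TangentSpace I) x₀).baseSet := by
    simpa using hs
  have h2 : (trivializationAt E (TangentSpace I) x₀ ⟨x₀, w⟩).2 = w := by
    rw [← Bundle.Trivialization.continuousLinearMapAt_apply_of_mem (R := ℝ) _
      (FiberBundle.mem_baseSet_trivializationAt' x₀)]
    exact congrArg (fun L : E →L[ℝ] E ↦ L w)
      ((TangentBundle.continuousLinearMapAt_trivializationAt (I := I) (𝕜 := ℝ)
        (mem_chart_source H x₀)).trans mfderiv_extChartAt_self)
  have h3 := Bundle.Trivialization.symmL_apply (R := ℝ)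
    (trivializationAt E (TangentSpace I) x₀) hb w
  refine Eq.trans ?_ (h3.symm.trans (congrArg (fun L ↦ L w) h1))
  simp only [FiberBundle.extend]
  rw [h2]

variable {g : FormField I M}

omit [I.Boundaryless] in
lemma localMetric_apply (g : FormField I M) (x₀ : M) (y v w : E) :
    localMetric I g x₀ y v w = g ((extChartAt I x₀).symm y)
      (mfderivWithin 𝓘(ℝ, E) I (extChartAt I x₀).symm (range I) y v)
      (mfderivWithin 𝓘(ℝ, E) I (extChartAt I x₀).symm (range I) y w) := rfl

omit [I.Boundaryless] in
lemma localMetric_self [IsManifold I 1 M] (g : FormField I M) (x₀ : M)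
    (v w : TangentSpace I x₀) :
    localMetric I g x₀ (extChartAt I x₀ x₀) v w = g x₀ v w := by
  -- The base point is generalized, as the type of `g p` depends on it.
  have h : ∀ p q : M, p = q → ∀ v w : E, (g p : E →L[ℝ] E →L[ℝ] ℝ) v w =
      (g q : E →L[ℝ] E →L[ℝ] ℝ) v w := by rintro p _ rfl v w; rfl
  have hA (v : E) :
      (mfderivWithin 𝓘(ℝ, E) I (extChartAt I x₀).symm (range I) (extChartAt I x₀ x₀) v : E) = v :=
    congrArg (fun L : E →L[ℝ] E ↦ L v) (mfderivWithin_range_extChartAt_symm (I := I) (𝕜 := ℝ))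
  exact (congrArg₂ (fun v w : E ↦ (g ((extChartAt I x₀).symm (extChartAt I x₀ x₀)) :
    E →L[ℝ] E →L[ℝ] ℝ) v w) (hA v) (hA w)).trans (h _ _ (extChartAt_to_inv x₀) v w)

/-- The coordinate expression of a metric is differentiable: its coefficients are the values of `g`
on the fields with constant components, which are differentiable sections. -/
lemma differentiableAt_localMetric [FiniteDimensional ℝ E] [IsManifold I ∞ M]
    (hg : IsSemiRiemannianMetric I g) (x₀ : M) :
    DifferentiableAt ℝ (localMetric I g x₀) (extChartAt I x₀ x₀) := by
  refine differentiableAt_clm fun v ↦ differentiableAt_clm fun w ↦ ?_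
  have h1 : MDifferentiableAt I (I.prod 𝓘(ℝ)) (fun x ↦ Bundle.TotalSpace.mk' ℝ
      (E := Bundle.Trivial M ℝ) x (g x (FiberBundle.extend E (x := x₀) (v : TangentSpace I x₀) x)
        (FiberBundle.extend E (x := x₀) (w : TangentSpace I x₀) x))) x₀ := by
    apply MDifferentiableAt.clm_bundle_apply₂ (F₁ := E) (F₂ := E)
    · exact (hg.smooth x₀).mdifferentiableAt (by simp)
    · exact FiberBundle.mdifferentiableAt_extend ..
    · exact FiberBundle.mdifferentiableAt_extend ..
  simp only [mdifferentiableAt_totalSpace] at h1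
  refine (differentiableAt_chart (F := ℝ) h1.2).congr_of_eventuallyEq ?_
  filter_upwards [extChartAt_target_mem_nhds (I := I) x₀] with y hy
  rw [localMetric_apply, ← extend_extChartAt_symm hy v, ← extend_extChartAt_symm hy w]
  rfl

omit [I.Boundaryless] in
lemma localMetric_symm [IsManifold I ∞ M] (hg : IsSemiRiemannianMetric I g) (x₀ : M)
    (y v w : E) : localMetric I g x₀ y v w = localMetric I g x₀ y w v := by
  rw [localMetric_apply, localMetric_apply, hg.symm]

omit [I.Boundaryless] in
lemma isInvertible_metric [FiniteDimensional ℝ E] [IsManifold I ∞ M]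
    (hg : IsSemiRiemannianMetric I g) (x : M) : (g x).IsInvertible :=
  isInvertible_of_nondegenerate (E := E) (B := g x) (hg.nondegenerate x)

omit [I.Boundaryless] in
lemma isInvertible_localMetric [FiniteDimensional ℝ E] [IsManifold I ∞ M]
    (hg : IsSemiRiemannianMetric I g) (x₀ : M) :
    (localMetric I g x₀ (extChartAt I x₀ x₀)).IsInvertible := by
  exact isInvertible_of_nondegenerate fun v hv ↦ hg.nondegenerate x₀ v fun w ↦
    (localMetric_self g x₀ v w).symm.trans (hv w)

lemma christoffel_eq_coordChristoffel (g : FormField I M) (x₀ : M) (v w : E) :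
    christoffel I g x₀ v w =
      coordChristoffel (localMetric I g x₀) (extChartAt I x₀ x₀) v w := by
  simp only [christoffel, coordChristoffel, I.range_eq_univ, fderivWithin_univ]

variable (I) in
/-- The components in the chart at `x₀` of a vector field `V`, as a function on the chart. -/
noncomputable def chartComponents (V : ∀ x : M, TangentSpace I x) (x₀ : M) (y : E) : E :=
  mfderiv I 𝓘(ℝ, E) (extChartAt I x₀) ((extChartAt I x₀).symm y) (V ((extChartAt I x₀).symm y))

omit [I.Boundaryless] in
lemma chartComponents_self [IsManifold I 1 M] (V : ∀ x : M, TangentSpace I x) (x₀ : M) :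
    chartComponents I V x₀ (extChartAt I x₀ x₀) = V x₀ := by
  have h : ∀ p q : M, p = q → (mfderiv I 𝓘(ℝ, E) (extChartAt I x₀) p (V p) : E) =
      mfderiv I 𝓘(ℝ, E) (extChartAt I x₀) q (V q) := by rintro p _ rfl; rfl
  rw [chartComponents, h _ _ (extChartAt_to_inv x₀), mfderiv_extChartAt_self]
  rfl

omit [I.Boundaryless] in
lemma mfderivWithin_symm_chartComponents [IsManifold I 1 M] (V : ∀ x : M, TangentSpace I x) {x₀ : M}
    {y : E} (hy : y ∈ (extChartAt I x₀).target) :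
    mfderivWithin 𝓘(ℝ, E) I (extChartAt I x₀).symm (range I) y
      (chartComponents I V x₀ y : E) =
      V ((extChartAt I x₀).symm y) :=
  congrArg (fun L ↦ L (V ((extChartAt I x₀).symm y)))
    (mfderivWithin_extChartAt_symm_comp_mfderiv_extChartAt hy)

/-- The covariant derivative in coordinates: `∇_v V = ∂_v V + Γ(v, V)`. -/
lemma covDeriv_eq [IsManifold I 1 M] (g : FormField I M) (V : ∀ x : M, TangentSpace I x) (x₀ : M)
    (hV : DifferentiableAt ℝ (chartComponents I V x₀) (extChartAt I x₀ x₀))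
    (v : TangentSpace I x₀) :
    covDeriv I g V x₀ v = fderiv ℝ (chartComponents I V x₀) (extChartAt I x₀ x₀) v +
      coordChristoffel (localMetric I g x₀) (extChartAt I x₀ x₀) v (V x₀) := by
  have h1 := mvfderiv_eq_fderiv_chart (I := I) (x₀ := x₀) (F := E)
    (f := fun x ↦ mfderiv I 𝓘(ℝ, E) (extChartAt I x₀) x (V x)) hV v
  have h2 (w : E) : (mfderiv I 𝓘(ℝ, E) (extChartAt I x₀) x₀ w : E) = w :=
    congrArg (fun L : E →L[ℝ] E ↦ L w) (mfderiv_extChartAt_self (I := I) (𝕜 := ℝ))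
  have h3 (w : E) : ((mfderiv I 𝓘(ℝ, E) (extChartAt I x₀) x₀).inverse w : E) = w :=
    (congrArg (fun L : E →L[ℝ] E ↦ L.inverse w)
      (mfderiv_extChartAt_self (I := I) (𝕜 := ℝ))).trans
      (congrArg (fun L : E →L[ℝ] E ↦ L w) ContinuousLinearMap.inverse_id)
  have h4 (w : E) : (mfderiv I I (id : M → M) x₀ w : E) = w :=
    congrArg (fun L : E →L[ℝ] E ↦ L w) (mfderiv_id (I := I) (𝕜 := ℝ))
  refine (h3 _).trans ?_
  refine congrArg₂ (fun a b : E ↦ a + b) h1 ?_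
  refine (christoffel_eq_coordChristoffel g x₀ _ _).trans ?_
  exact congrArg₂ (coordChristoffel (localMetric I g x₀) (extChartAt I x₀ x₀))
    ((h2 _).trans (h4 v)) (h2 (V x₀))

variable {u : M → ℝ}

omit [I.Boundaryless] in
lemma apply_gradient [FiniteDimensional ℝ E] [IsManifold I ∞ M]
    (hg : IsSemiRiemannianMetric I g) (u : M → ℝ) (x : M) (w : TangentSpace I x) :
    g x (gradient I g u x) w = mvfderiv I u x w :=
  congrArg (fun L : E →L[ℝ] ℝ ↦ L w)
    (apply_inverse_self (E := E) (isInvertible_metric hg x) (mvfderiv I u x))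

lemma localMetric_chartComponents_gradient [FiniteDimensional ℝ E] [IsManifold I ∞ M]
    (hg : IsSemiRiemannianMetric I g) (hu : ContMDiff I 𝓘(ℝ, ℝ) 2 u) {x₀ : M} {y : E}
    (hy : y ∈ (extChartAt I x₀).target) :
    localMetric I g x₀ y (chartComponents I (gradient I g u) x₀ y) =
      fderiv ℝ (u ∘ (extChartAt I x₀).symm) y := by
  ext w
  rw [localMetric_apply, mfderivWithin_symm_chartComponents _ hy, apply_gradient hg,
    fderiv_comp_extChartAt_symm hy (hu.mdifferentiable (by norm_num) _)]

omit [I.Boundaryless] in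
lemma localMetric_chartComponents_gradient_self [FiniteDimensional ℝ E] [IsManifold I ∞ M]
    {x₀ : M} {y : E} (hy : y ∈ (extChartAt I x₀).target) :
    localMetric I g x₀ y (chartComponents I (gradient I g u) x₀ y)
      (chartComponents I (gradient I g u) x₀ y) =
    g ((extChartAt I x₀).symm y) (gradient I g u ((extChartAt I x₀).symm y))
      (gradient I g u ((extChartAt I x₀).symm y)) := by
  rw [localMetric_apply, mfderivWithin_symm_chartComponents _ hy]

end Charts

/-! ### The covariant derivative of `∇u / W` -/

section Graph

variable {E : Type*} [NormedAddCommGroup E] [NormedSpace ℝ E] [FiniteDimensional ℝ E]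
  {H : Type*} [TopologicalSpace H] {I : ModelWithCorners ℝ E H} [I.Boundaryless]
  {M : Type*} [TopologicalSpace M] [ChartedSpace H M] [IsManifold I ∞ M]
  {g : FormField I M} {u : M → ℝ}

omit [FiniteDimensional ℝ E] [IsManifold I ∞ M] in
lemma mvfderiv_eq_fderiv_chart_of_contMDiff (hu : ContMDiff I 𝓘(ℝ, ℝ) 2 u) (x₀ : M) (v : E) :
    mvfderiv I u x₀ v = fderiv ℝ (u ∘ (extChartAt I x₀).symm) (extChartAt I x₀ x₀) v :=
  mvfderiv_eq_fderiv_chart (differentiableAt_chart (hu.mdifferentiable (by norm_num) x₀)) v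

/-- The Hessian `Hess u(v, w) = ∂²u(v, w) - du(Γ(v, w))` at `x₀`, computed in the preferred chart at
`x₀`; its arguments are tangent vectors at `x₀`, that is, vectors of the model space. -/
noncomputable def hessian (g : FormField I M) (u : M → ℝ) (x₀ : M) (v w : E) : ℝ :=
  coordHessian (localMetric I g x₀) (u ∘ (extChartAt I x₀).symm) (extChartAt I x₀ x₀) v w

/-- The covariant derivative of `∇u / W` is `1 / W` times the endomorphism `T` which represents the
Hessian of `u` with respect to the metric `g + ε du²` of the graph. -/
lemma exists_covDeriv_normalized_gradient (hg : IsSemiRiemannianMetric I g)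
    (hu : ContMDiff I 𝓘(ℝ, ℝ) 2 u) {ε ε' : ℝ} (hε : ε = 1 ∨ ε = -1) (x₀ : M)
    (hpos : 0 < ε' * (ε + g x₀ (gradient I g u x₀) (gradient I g u x₀))) :
    ∃ T : E → E,
      (∀ v : E, covDeriv I g (fun x ↦ (1 / graphW I g ε ε' u x) • gradient I g u x) x₀ v =
        (1 / graphW I g ε ε' u x₀) • T v) ∧
      ∀ v z : E, (g x₀ : E →L[ℝ] E →L[ℝ] ℝ) (T v) z +
        ε * (mvfderiv I u x₀ (T v) * mvfderiv I u x₀ z) = hessian g u x₀ v z := by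
  set G := localMetric I g x₀ with hGdef
  set y₀ := extChartAt I x₀ x₀ with hy₀
  set f : E → ℝ := u ∘ (extChartAt I x₀).symm with hf
  set Z : E → E := chartComponents I (gradient I g u) x₀ with hZdef
  have hG : DifferentiableAt ℝ G y₀ := differentiableAt_localMetric hg x₀
  have hinv : (G y₀).IsInvertible := isInvertible_localMetric hg x₀
  have hsymm : ∀ᶠ y in 𝓝 y₀, ∀ v w, G y v w = G y w v :=
    Eventually.of_forall fun y v w ↦ localMetric_symm hg x₀ y v w
  have hf2 : ContDiffAt ℝ 2 f y₀ := contDiffAt_chart (hu x₀)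
  have htarget : ∀ᶠ y in 𝓝 y₀, y ∈ (extChartAt I x₀).target :=
    extChartAt_target_mem_nhds (I := I) x₀
  have hZ : ∀ᶠ y in 𝓝 y₀, G y (Z y) = fderiv ℝ f y :=
    htarget.mono fun y hy ↦ localMetric_chartComponents_gradient hg hu hy
  have hZ₀ : Z y₀ = gradient I g u x₀ := chartComponents_self _ x₀
  have hq : G y₀ (Z y₀) (Z y₀) = g x₀ (gradient I g u x₀) (gradient I g u x₀) :=
    (congrArg (fun z : E ↦ G y₀ z z) hZ₀).trans (localMetric_self g x₀ _ _)
  have hpos' : 0 < ε' * (ε + G y₀ (Z y₀) (Z y₀)) := by rwa [hq]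
  have hne : ε + G y₀ (Z y₀) (Z y₀) ≠ 0 := by intro h; simp [h] at hpos'
  obtain ⟨hVd, hV⟩ := covDeriv_normalized_coordGradient hG hinv hsymm hf2 hZ hpos'
  have hW : √(ε' * (ε + G y₀ (Z y₀) (Z y₀))) = graphW I g ε ε' u x₀ := by rw [hq]; rfl
  have hcomp : chartComponents I (fun x ↦ (1 / graphW I g ε ε' u x) • gradient I g u x) x₀ =ᶠ[𝓝 y₀]
      fun y ↦ (1 / √(ε' * (ε + G y (Z y) (Z y)))) • Z y := by
    filter_upwards [htarget] with y hy
    rw [localMetric_chartComponents_gradient_self hy]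
    exact map_smul (mfderiv I 𝓘(ℝ, E) (extChartAt I x₀) ((extChartAt I x₀).symm y)) _ _
  refine ⟨fun v ↦ fderiv ℝ Z y₀ v + coordChristoffel G y₀ v (Z y₀) -
      (coordHessian G f y₀ v (Z y₀) / (ε + G y₀ (Z y₀) (Z y₀))) • Z y₀, fun v ↦ ?_, fun v z ↦ ?_⟩
  · have h1 := covDeriv_eq g _ x₀ (hVd.congr_of_eventuallyEq hcomp) v
    refine h1.trans ?_
    rw [hcomp.fderiv_eq, ← hW, ← hV v]
    refine congrArg (fun w : E ↦
      fderiv ℝ (fun y ↦ (1 / √(ε' * (ε + G y (Z y) (Z y)))) • Z y) y₀ v + coordChristoffel G y₀ v w) ?_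
    exact congrArg (fun w : E ↦ (1 / √(ε' * (ε + G y₀ (Z y₀) (Z y₀)))) • w) hZ₀.symm
  · have h1 := apply_trace_endomorphism hG hinv hsymm hf2 hZ hε hne v z rfl
    refine Eq.trans ?_ h1
    refine congrArg₂ (fun a b : ℝ ↦ a + ε * b) (localMetric_self g x₀ _ z).symm ?_
    exact congrArg₂ (fun a b : ℝ ↦ a * b) (mvfderiv_eq_fderiv_chart_of_contMDiff hu x₀ _)
      (mvfderiv_eq_fderiv_chart_of_contMDiff hu x₀ z)

/-! ### The product metric -/

omit [FiniteDimensional ℝ E] [I.Boundaryless] [IsManifold I ∞ M] in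
lemma productMetric_apply (g : FormField I M) (ε : ℝ) (p : M × ℝ) (v w : E × ℝ) :
    (productMetric I g ε p : (E × ℝ) →L[ℝ] (E × ℝ) →L[ℝ] ℝ) v w =
      (g p.1 : E →L[ℝ] E →L[ℝ] ℝ) v.1 w.1 + ε * (v.2 * w.2) := by
  have h1 (v : E × ℝ) : (mfderiv (I.prod 𝓘(ℝ, ℝ)) I (Prod.fst : M × ℝ → M) p v : E) = v.1 :=
    congrArg (fun L : (E × ℝ) →L[ℝ] E ↦ L v) (mfderiv_fst (I := I) (I' := 𝓘(ℝ, ℝ)))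
  have h2 (v : E × ℝ) : dt I p v = v.2 :=
    congrArg (fun L : (E × ℝ) →L[ℝ] ℝ ↦ L v) (mfderiv_snd (I := I) (I' := 𝓘(ℝ, ℝ)))
  exact congrArg₂ (fun a b : ℝ ↦ a + ε * b)
    (congrArg₂ (fun v w : E ↦ (g p.1 : E →L[ℝ] E →L[ℝ] ℝ) v w) (h1 v) (h1 w))
    (congrArg₂ (fun a b : ℝ ↦ a * b) (h2 v) (h2 w))

omit [FiniteDimensional ℝ E] in
/-- In the product chart the metric `g + ε dt²` reads `G + ε dt²`. -/
lemma localMetric_productMetric (g : FormField I M) (ε : ℝ) (p : M × ℝ) {q : E × ℝ}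
    (hq : q.1 ∈ (extChartAt I p.1).target) (v w : E × ℝ) :
    localMetric (I.prod 𝓘(ℝ, ℝ)) (productMetric I g ε) p q v w =
      localMetric I g p.1 q.1 v.1 w.1 + ε * (v.2 * w.2) := by
  have hsymm : ((extChartAt (I.prod 𝓘(ℝ, ℝ)) p).symm : E × ℝ → M × ℝ) =
      fun q ↦ ((extChartAt I p.1).symm q.1, q.2) := by
    rw [extChartAt_prod]; rfl
  -- The inverse of the product chart has the differential `dφ⁻¹ × id`, where `φ` is the chart of `M`.
  have hA : ∀ v : E × ℝ, (mfderivWithin 𝓘(ℝ, E × ℝ) (I.prod 𝓘(ℝ, ℝ))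
        (extChartAt (I.prod 𝓘(ℝ, ℝ)) p).symm (range (I.prod 𝓘(ℝ, ℝ))) q v : E × ℝ) =
      ((mfderivWithin 𝓘(ℝ, E) I (extChartAt I p.1).symm (range I) q.1 v.1 : E), v.2) := by
    intro v
    rw [ModelWithCorners.range_eq_univ, mfderivWithin_univ, I.range_eq_univ, mfderivWithin_univ,
      hsymm]
    have h1 : HasMFDerivAt 𝓘(ℝ, E × ℝ) I (fun q : E × ℝ ↦ (extChartAt I p.1).symm q.1) q
        ((mfderiv 𝓘(ℝ, E) I (extChartAt I p.1).symm q.1).comp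
          (ContinuousLinearMap.fst ℝ E ℝ)) :=
      (mdifferentiableAt_extChartAt_symm hq).hasMFDerivAt.comp q
        (ContinuousLinearMap.fst ℝ E ℝ).hasMFDerivAt
    have h2 : HasMFDerivAt 𝓘(ℝ, E × ℝ) 𝓘(ℝ, ℝ) (fun q : E × ℝ ↦ q.2) q
        (ContinuousLinearMap.snd ℝ E ℝ) := (ContinuousLinearMap.snd ℝ E ℝ).hasMFDerivAt
    exact congrArg (fun L : (E × ℝ) →L[ℝ] (E × ℝ) ↦ L v) (h1.prodMk h2).mfderiv
  have h3 : localMetric (I.prod 𝓘(ℝ, ℝ)) (productMetric I g ε) p q v w = _ :=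
    productMetric_apply g ε ((extChartAt (I.prod 𝓘(ℝ, ℝ)) p).symm q)
    (mfderivWithin 𝓘(ℝ, E × ℝ) (I.prod 𝓘(ℝ, ℝ))
        (extChartAt (I.prod 𝓘(ℝ, ℝ)) p).symm (range (I.prod 𝓘(ℝ, ℝ))) q v)
    (mfderivWithin 𝓘(ℝ, E × ℝ) (I.prod 𝓘(ℝ, ℝ))
        (extChartAt (I.prod 𝓘(ℝ, ℝ)) p).symm (range (I.prod 𝓘(ℝ, ℝ))) q w)
  have h4 : ((extChartAt (I.prod 𝓘(ℝ, ℝ)) p).symm q).1 = (extChartAt I p.1).symm q.1 := by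
    rw [hsymm]
  have h : ∀ p q : M, p = q → ∀ v w : E, (g p : E →L[ℝ] E →L[ℝ] ℝ) v w =
      (g q : E →L[ℝ] E →L[ℝ] ℝ) v w := by rintro p _ rfl v w; rfl
  refine h3.trans (congrArg₂ (fun a b : ℝ ↦ a + ε * b) ?_ ?_)
  · exact (congrArg₂ (fun v w : E × ℝ ↦ (g ((extChartAt (I.prod 𝓘(ℝ, ℝ)) p).symm q).1 :
      E →L[ℝ] E →L[ℝ] ℝ) v.1 w.1) (hA v) (hA w)).trans (h _ _ h4 _ _)
  · have h5 := fun v ↦ congrArg Prod.snd (hA v)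
    exact congrArg₂ (fun a b : ℝ ↦ a * b) (h5 v) (h5 w)

end Graph

/-! ### The Levi-Civita connection of a product -/

section ProductChristoffel

variable {E : Type*} [NormedAddCommGroup E] [NormedSpace ℝ E] [FiniteDimensional ℝ E]

/-- The Christoffel symbols of `G + ε dt²` are those of `G`, with vanishing `t`-component. -/
lemma coordChristoffel_prod {G : E → E →L[ℝ] E →L[ℝ] ℝ}
    {K : E × ℝ → (E × ℝ) →L[ℝ] (E × ℝ) →L[ℝ] ℝ} {q : E × ℝ} {ε : ℝ} (hε : ε ≠ 0)
    (hG : DifferentiableAt ℝ G q.1) (hinv : (G q.1).IsInvertible)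
    (hK : ∀ᶠ q' in 𝓝 q, ∀ v w, K q' v w = G q'.1 v.1 w.1 + ε * (v.2 * w.2)) (v w : E × ℝ) :
    coordChristoffel K q v w = (coordChristoffel G q.1 v.1 w.1, 0) := by
  have hd : ∀ v w, HasFDerivAt (fun q' ↦ K q' v w)
      ((((fderiv ℝ G q.1).flip v.1).flip w.1).comp (ContinuousLinearMap.fst ℝ E ℝ)) q := by
    intro v w
    have h1 : HasFDerivAt (fun y ↦ G y v.1 w.1) (((fderiv ℝ G q.1).flip v.1).flip w.1) q.1 := by
      have := (hG.hasFDerivAt.clm_apply (hasFDerivAt_const v.1 q.1)).clm_apply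
        (hasFDerivAt_const w.1 q.1)
      convert! this using 1
      ext z
      simp
    refine ((h1.comp q hasFDerivAt_fst).add_const (ε * (v.2 * w.2))).congr_of_eventuallyEq ?_
    filter_upwards [hK] with q' hq' using hq' v w
  have hKd : DifferentiableAt ℝ K q :=
    differentiableAt_clm fun v ↦ differentiableAt_clm fun w ↦ (hd v w).differentiableAt
  have hfd : ∀ z v w, fderiv ℝ K q z v w = fderiv ℝ G q.1 z.1 v.1 w.1 := fun z v w ↦ by
    rw [← fderiv_apply_const₂ hKd, (hd v w).fderiv]
    simp
  -- Pairing with `(w, 0)` and with `(0, 1)` separates the two components.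
  have hKinv : (K q).IsInvertible := by
    refine isInvertible_of_nondegenerate fun v hv ↦ ?_
    simp only [hK.self_of_nhds] at hv
    refine Prod.ext (hinv.injective ?_) ?_
    · ext w
      simpa using hv (w, 0)
    · simpa [hε] using hv (0, 1)
  refine hKinv.injective (ContinuousLinearMap.ext fun z ↦ ?_)
  rw [apply_coordChristoffel hKd hKinv, hK.self_of_nhds, apply_coordChristoffel hG hinv]
  simp [hfd]

end ProductChristoffel

/-! ### The covariant derivative along a graph -/

section Graph

variable {E : Type*} [NormedAddCommGroup E] [NormedSpace ℝ E]
  {H : Type*} [TopologicalSpace H] {I : ModelWithCorners ℝ E H}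
  {M : Type*} [TopologicalSpace M] [ChartedSpace H M]
  {g : FormField I M} {u : M → ℝ}

lemma mfderiv_graphMap {x : M} (hu : MDifferentiableAt I 𝓘(ℝ, ℝ) u x) (v : E) :
    (mfderiv I (I.prod 𝓘(ℝ, ℝ)) (graphMap u) x v : E × ℝ) = (v, mvfderiv I u x v) :=
  congrArg (fun L : E →L[ℝ] E × ℝ ↦ L v)
    ((HasMFDerivAt.prodMk (hasMFDerivAt_id x) hu.hasMFDerivAt).mfderiv)

lemma pullback_productMetric_graphMap (g : FormField I M) (ε : ℝ) {x : M}
    (hu : MDifferentiableAt I 𝓘(ℝ, ℝ) u x) (v w : E) :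
    (pullback I (I.prod 𝓘(ℝ, ℝ)) (productMetric I g ε) (graphMap u) x : E →L[ℝ] E →L[ℝ] ℝ) v w =
      (g x : E →L[ℝ] E →L[ℝ] ℝ) v w + ε * (mvfderiv I u x v * mvfderiv I u x w) :=
  (congrArg₂ (fun v w : E × ℝ ↦ (productMetric I g ε (graphMap u x) :
      (E × ℝ) →L[ℝ] (E × ℝ) →L[ℝ] ℝ) v w) (mfderiv_graphMap hu v) (mfderiv_graphMap hu w)).trans
    (productMetric_apply g ε (graphMap u x) _ _)

variable [FiniteDimensional ℝ E] [I.Boundaryless] [IsManifold I ∞ M]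

omit [FiniteDimensional ℝ E] in
/-- In the product chart the graph map is `y ↦ (y, u y)`, so the coordinate field `dF(∂_w)` has the
components `(w, ∂_w u)`. -/
lemma graph_chart_components (hu : ContMDiff I 𝓘(ℝ, ℝ) 2 u) (x₀ : M) (w : E) {y : E}
    (hy : y ∈ (extChartAt I x₀).target) :
    (mfderiv (I.prod 𝓘(ℝ, ℝ)) 𝓘(ℝ, E × ℝ) (extChartAt (I.prod 𝓘(ℝ, ℝ)) (graphMap u x₀))
      (graphMap u ((extChartAt I x₀).symm y))
      (mfderiv I (I.prod 𝓘(ℝ, ℝ)) (graphMap u) ((extChartAt I x₀).symm y)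
        (FiberBundle.extend E (x := x₀) (w : TangentSpace I x₀) ((extChartAt I x₀).symm y))) : E × ℝ) =
    (w, fderiv ℝ (u ∘ (extChartAt I x₀).symm) y w) := by
  set p := (extChartAt I x₀).symm y with hp
  have hps : p ∈ (chartAt H x₀).source := by
    rw [← extChartAt_source (I := I)]; exact (extChartAt I x₀).map_target hy
  have hud : ∀ x, MDifferentiableAt I 𝓘(ℝ, ℝ) u x := hu.mdifferentiable (by norm_num)
  have hFd : MDifferentiableAt I (I.prod 𝓘(ℝ, ℝ)) (graphMap u) p :=
    mdifferentiableAt_id.prodMk (hud p)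
  have hψd : MDifferentiableAt (I.prod 𝓘(ℝ, ℝ)) 𝓘(ℝ, E × ℝ)
      (extChartAt (I.prod 𝓘(ℝ, ℝ)) (graphMap u x₀)) (graphMap u p) := by
    refine mdifferentiableAt_extChartAt ?_
    rw [prodChartedSpace_chartAt]
    exact ⟨hps, by rw [chartAt_self_eq]; trivial⟩
  have h1 : fderiv ℝ ((extChartAt (I.prod 𝓘(ℝ, ℝ)) (graphMap u x₀) ∘ graphMap u) ∘
      (extChartAt I x₀).symm) y w = _ :=
    fderiv_comp_extChartAt_symm (F := E × ℝ) hy (hψd.comp p hFd) w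
  have h2 : ((extChartAt (I.prod 𝓘(ℝ, ℝ)) (graphMap u x₀) ∘ graphMap u) ∘
      (extChartAt I x₀).symm : E → E × ℝ) =ᶠ[𝓝 y] fun y ↦ (y, (u ∘ (extChartAt I x₀).symm) y) := by
    filter_upwards [extChartAt_target_mem_nhds' (I := I) hy] with y' hy'
    rw [extChartAt_prod]
    exact Prod.ext ((extChartAt I x₀).right_inv hy') rfl
  have h3 : DifferentiableAt ℝ (u ∘ (extChartAt I x₀).symm) y :=
    ((hud p).comp y (mdifferentiableAt_extChartAt_symm hy)).differentiableAt
  have h4 := (hasFDerivAt_id (𝕜 := ℝ) y).prodMk h3.hasFDerivAt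
  have h5 : fderiv ℝ ((extChartAt (I.prod 𝓘(ℝ, ℝ)) (graphMap u x₀) ∘ graphMap u) ∘
      (extChartAt I x₀).symm) y w = (w, fderiv ℝ (u ∘ (extChartAt I x₀).symm) y w) := by
    rw [h2.fderiv_eq]
    exact congrArg (fun L : E →L[ℝ] E × ℝ ↦ L w) h4.fderiv
  refine Eq.trans ?_ (h1.symm.trans h5)
  refine (congrArg (fun X : E ↦ (mfderiv (I.prod 𝓘(ℝ, ℝ)) 𝓘(ℝ, E × ℝ)
    (extChartAt (I.prod 𝓘(ℝ, ℝ)) (graphMap u x₀)) (graphMap u p)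
    (mfderiv I (I.prod 𝓘(ℝ, ℝ)) (graphMap u) p X) : E × ℝ)) (extend_extChartAt_symm hy w)).trans ?_
  exact congrArg (fun L : E →L[ℝ] E × ℝ ↦
    L (mfderivWithin 𝓘(ℝ, E) I (extChartAt I x₀).symm (range I) y w))
    (mfderiv_comp p hψd hFd).symm

/-- The covariant derivative of the coordinate field `dF(∂_w)` along a graph. -/
lemma covDerivAlong_graphMap (hg : IsSemiRiemannianMetric I g) (hu : ContMDiff I 𝓘(ℝ, ℝ) 2 u)
    {ε : ℝ} (hε : ε ≠ 0) (x₀ : M) (v w : E) :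
    (covDerivAlong I (I.prod 𝓘(ℝ, ℝ)) (productMetric I g ε) (graphMap u)
      (fun x ↦ mfderiv I (I.prod 𝓘(ℝ, ℝ)) (graphMap u) x
        (FiberBundle.extend E (x := x₀) (w : TangentSpace I x₀) x)) x₀ v : E × ℝ) =
    (coordChristoffel (localMetric I g x₀) (extChartAt I x₀ x₀) v w,
      fderiv ℝ (fderiv ℝ (u ∘ (extChartAt I x₀).symm)) (extChartAt I x₀ x₀) v w) := by
  set f : E → ℝ := u ∘ (extChartAt I x₀).symm with hf
  set y₀ := extChartAt I x₀ x₀ with hy₀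
  have hud : MDifferentiableAt I 𝓘(ℝ, ℝ) u x₀ := hu.mdifferentiable (by norm_num) x₀
  have hf2 : DifferentiableAt ℝ (fderiv ℝ f) y₀ :=
    ((contDiffAt_chart (hu x₀)).fderiv_right (m := 1) (by norm_num)).differentiableAt one_ne_zero
  -- The components of `dF(∂_w)` in the product chart at `F x₀`, as in `covDerivAlong`.
  let Vloc : M → E × ℝ := fun x ↦ mfderiv (I.prod 𝓘(ℝ, ℝ)) 𝓘(ℝ, E × ℝ)
    (extChartAt (I.prod 𝓘(ℝ, ℝ)) (graphMap u x₀)) (graphMap u x)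
      (mfderiv I (I.prod 𝓘(ℝ, ℝ)) (graphMap u) x
        (FiberBundle.extend E (x := x₀) (w : TangentSpace I x₀) x))
  have hVloc : Vloc ∘ (extChartAt I x₀).symm =ᶠ[𝓝 y₀] fun y ↦ (w, fderiv ℝ f y w) := by
    filter_upwards [extChartAt_target_mem_nhds (I := I) x₀] with y hy
    exact graph_chart_components hu x₀ w hy
  have hd : HasFDerivAt (fun y ↦ (w, fderiv ℝ f y w))
      ((0 : E →L[ℝ] E).prod ((fderiv ℝ (fderiv ℝ f) y₀).flip w)) y₀ := by
    refine (hasFDerivAt_const w y₀).prodMk ?_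
    convert! hf2.hasFDerivAt.clm_apply (hasFDerivAt_const w y₀) using 1
    ext z
    simp
  have hd' := hd.congr_of_eventuallyEq hVloc
  have h1 : mvfderiv I Vloc x₀ v = (0, fderiv ℝ (fderiv ℝ f) y₀ v w) := by
    refine (mvfderiv_eq_fderiv_chart hd'.differentiableAt v).trans ?_
    rw [← hy₀, hd'.fderiv]
    simp
  have h2 (ξ : E × ℝ) : (mfderiv (I.prod 𝓘(ℝ, ℝ)) 𝓘(ℝ, E × ℝ)
      (extChartAt (I.prod 𝓘(ℝ, ℝ)) (graphMap u x₀)) (graphMap u x₀) ξ : E × ℝ) = ξ :=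
    congrArg (fun L : (E × ℝ) →L[ℝ] E × ℝ ↦ L ξ)
      (mfderiv_extChartAt_self (I := I.prod 𝓘(ℝ, ℝ)) (𝕜 := ℝ))
  have h3 (ξ : E × ℝ) : ((mfderiv (I.prod 𝓘(ℝ, ℝ)) 𝓘(ℝ, E × ℝ)
      (extChartAt (I.prod 𝓘(ℝ, ℝ)) (graphMap u x₀)) (graphMap u x₀)).inverse ξ : E × ℝ) = ξ :=
    (congrArg (fun L : (E × ℝ) →L[ℝ] E × ℝ ↦ L.inverse ξ)
      (mfderiv_extChartAt_self (I := I.prod 𝓘(ℝ, ℝ)) (𝕜 := ℝ))).trans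
      (congrArg (fun L : (E × ℝ) →L[ℝ] E × ℝ ↦ L ξ) ContinuousLinearMap.inverse_id)
  have hext : (FiberBundle.extend E (x := x₀) (w : TangentSpace I x₀) x₀ : TangentSpace I x₀) = w :=
    FiberBundle.extend_apply_self (E := fun x : M ↦ TangentSpace I x) E (x := x₀) w
  have h4 : Vloc x₀ = (w, mvfderiv I u x₀ w) := by
    refine (h2 _).trans ((mfderiv_graphMap hud _).trans ?_)
    exact congrArg (fun w : E ↦ (w, mvfderiv I u x₀ w)) hext
  have h5 : (extChartAt (I.prod 𝓘(ℝ, ℝ)) (graphMap u x₀) (graphMap u x₀)).1 = y₀ := by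
    rw [extChartAt_prod]; rfl
  have h6 : ∀ a b : E × ℝ, christoffel (I.prod 𝓘(ℝ, ℝ)) (productMetric I g ε) (graphMap u x₀) a b =
      (coordChristoffel (localMetric I g x₀) y₀ a.1 b.1, 0) := by
    intro a b
    rw [christoffel_eq_coordChristoffel, coordChristoffel_prod (G := localMetric I g x₀) hε]
    · rw [h5]
    · rw [h5]; exact differentiableAt_localMetric hg x₀
    · rw [h5]; exact isInvertible_localMetric hg x₀
    · have h7 : ∀ᶠ y in 𝓝 (extChartAt (I.prod 𝓘(ℝ, ℝ)) (graphMap u x₀) (graphMap u x₀)).1,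
          y ∈ (extChartAt I x₀).target := by
        rw [h5]; exact extChartAt_target_mem_nhds (I := I) x₀
      filter_upwards [continuousAt_fst.eventually h7] with q hq
      exact localMetric_productMetric g ε (graphMap u x₀) hq
  refine (h3 _).trans ?_
  refine (congrArg₂ (fun a b : E × ℝ ↦ a + b) h1 ((h6 _ _).trans
    (congrArg₂ (fun a b : E × ℝ ↦ (coordChristoffel (localMetric I g x₀) y₀ a.1 b.1, (0 : ℝ)))
      ((h2 _).trans (mfderiv_graphMap hud v)) h4))).trans ?_
  simp

end Graph

/-! ### The normal component -/

section NormalPart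

variable {E : Type*} [NormedAddCommGroup E] [NormedSpace ℝ E] [FiniteDimensional ℝ E]
  {H : Type*} [TopologicalSpace H] {I : ModelWithCorners ℝ E H}
  {M : Type*} [TopologicalSpace M] [ChartedSpace H M]
  {E' : Type*} [NormedAddCommGroup E'] [NormedSpace ℝ E']
  {H' : Type*} [TopologicalSpace H'] {J : ModelWithCorners ℝ E' H'}
  {N : Type*} [TopologicalSpace N] [ChartedSpace H' N]
  {h : FormField J N} {F : M → N}

omit [FiniteDimensional ℝ E] in
lemma normalPart_add (x : M) (ξ η : TangentSpace J (F x)) :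
    normalPart I J h F x (ξ + η) = normalPart I J h F x ξ + normalPart I J h F x η := by
  simp only [normalPart, map_add, ContinuousLinearMap.add_comp]
  abel

omit [FiniteDimensional ℝ E] in
lemma normalPart_smul (x : M) (c : ℝ) (ξ : TangentSpace J (F x)) :
    normalPart I J h F x (c • ξ) = c • normalPart I J h F x ξ := by
  simp only [normalPart, map_smul, ContinuousLinearMap.smul_comp, smul_sub]

lemma normalPart_mfderiv (hF : IsSemiRiemannianImmersion I J h F) (x : M) (v : TangentSpace I x) :
    normalPart I J h F x (mfderiv I J F x v) = 0 := by
  have hinv : (pullback I J h F x).IsInvertible :=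
    isInvertible_of_nondegenerate (E := E) (B := pullback I J h F x) (hF.nondegenerate x)
  have h1 : (h (F x) (mfderiv I J F x v)) ∘L (mfderiv I J F x) = pullback I J h F x v := rfl
  rw [normalPart, h1, hinv.inverse_apply_self, sub_self]

end NormalPart

/-! ### The unit normal, the second fundamental form and the mean curvature of a graph -/

section Soliton

variable {E : Type*} [NormedAddCommGroup E] [NormedSpace ℝ E]
  {H : Type*} [TopologicalSpace H] {I : ModelWithCorners ℝ E H}
  {M : Type*} [TopologicalSpace M] [ChartedSpace H M]
  {g : FormField I M} {u : M → ℝ} {ε ε' : ℝ}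

lemma partialT_eq (p : M × ℝ) : (partialT I p : E × ℝ) = (0, 1) :=
  congrArg (fun L : ℝ →L[ℝ] E × ℝ ↦ L 1) (mfderiv_prod_right (I := I) (I' := 𝓘(ℝ, ℝ)))

lemma dt_eq (p : M × ℝ) (v : E × ℝ) : dt I p v = v.2 :=
  congrArg (fun L : (E × ℝ) →L[ℝ] ℝ ↦ L v) (mfderiv_snd (I := I) (I' := 𝓘(ℝ, ℝ)))

/-- The normal component of `∂_t` does not vanish, since `⟨ν, ∂_t⟩ = ε dt(ν) ≠ 0`. -/
lemma normalPart_partialT_ne_zero (hε : ε ≠ 0)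
    {ν : ∀ x : M, TangentSpace (I.prod 𝓘(ℝ, ℝ)) (graphMap u x)}
    (hν : IsUpwardUnitNormal I I (productMetric I g ε) (graphMap u) ε' ν) (x : M) :
    normalPart I (I.prod 𝓘(ℝ, ℝ)) (productMetric I g ε) (graphMap u) x
      (partialT I (graphMap u x)) ≠ 0 := by
  intro h0
  have h1 : productMetric I g ε (graphMap u x) (ν x) (partialT I (graphMap u x)) = 0 := by
    have h2 := congrArg (productMetric I g ε (graphMap u x) (ν x)) h0
    rwa [normalPart, map_sub, hν.orthogonal, sub_zero, map_zero] at h2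
  have h3 := productMetric_apply g ε (graphMap u x) (ν x) (partialT I (graphMap u x))
  have h4 : ε * (dt I (graphMap u x) (ν x)) = 0 := by
    have key : ∀ (B : E →L[ℝ] E →L[ℝ] ℝ) (n ξ : E × ℝ), ξ = (0, 1) →
        B n.1 ξ.1 + ε * (n.2 * ξ.2) = ε * n.2 := by rintro B n _ rfl; simp
    exact (congrArg (ε * ·) (dt_eq _ _)).trans
      ((key (g x) (ν x) _ (partialT_eq _)).symm.trans (h3.symm.trans h1))
  exact (mul_ne_zero hε (hν.upward x).ne') h4

variable [FiniteDimensional ℝ E] [IsManifold I ∞ M]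

/-- Orthogonality gives `ν = dt(ν) (-ε ∇u, 1)`, so that `ε' = ⟨ν, ν⟩ = dt(ν)² (ε + |∇u|²)`. -/
lemma normal_sign_eq (hg : IsSemiRiemannianMetric I g) (hu : ContMDiff I 𝓘(ℝ, ℝ) 2 u)
    (hε : ε = 1 ∨ ε = -1) {ν : ∀ x : M, TangentSpace (I.prod 𝓘(ℝ, ℝ)) (graphMap u x)}
    (hν : IsUpwardUnitNormal I I (productMetric I g ε) (graphMap u) ε' ν) (x : M) :
    ε' = dt I (graphMap u x) (ν x) ^ 2 *
      (ε + g x (gradient I g u x) (gradient I g u x)) := by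
  set a : E := (show E × ℝ from ν x).1 with ha
  set b : ℝ := (show E × ℝ from ν x).2 with hb
  set B : E →L[ℝ] E →L[ℝ] ℝ := g x with hB
  set Z : E := gradient I g u x with hZ
  have hε2 : ε ^ 2 = 1 := by rcases hε with rfl | rfl <;> norm_num
  have hinv : B.IsInvertible := isInvertible_metric hg x
  have hsymm : ∀ v w, B v w = B w v := hg.symm x
  have hdu : ∀ w : E, B Z w = mvfderiv I u x w := fun w ↦ apply_gradient hg u x w
  have horth : ∀ w : E, B a w + ε * (b * B Z w) = 0 := by
    intro w
    have h1 := hν.orthogonal x w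
    have h2 := productMetric_apply g ε (graphMap u x) (ν x)
      (mfderiv I (I.prod 𝓘(ℝ, ℝ)) (graphMap u) x w)
    have h3 := mfderiv_graphMap (hu.mdifferentiable (by norm_num) x) w
    rw [hdu]
    refine Eq.trans ?_ (h2.symm.trans h1)
    rw [h3]
    rfl
  have ha' : a = -(ε * b) • Z := by
    refine hinv.injective (ContinuousLinearMap.ext fun w ↦ ?_)
    rw [map_smul, smul_apply, smul_eq_mul]
    linear_combination horth w
  have hunit : B a a + ε * (b * b) = ε' :=
    (productMetric_apply g ε (graphMap u x) (ν x) (ν x)).symm.trans (hν.unit x)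
  have hdt : dt I (graphMap u x) (ν x) = b := dt_eq _ _
  rw [hdt]
  change ε' = b ^ 2 * (ε + B Z Z)
  rw [← hunit, ha']
  simp only [map_smul, smul_apply, smul_eq_mul]
  linear_combination (b ^ 2 * B Z Z) * hε2

/-- From `ε' = dt(ν)² (ε + |∇u|²)` one gets `ε' (ε + |∇u|²) = (dt(ν) (ε + |∇u|²))² > 0`. -/
lemma normal_sign_mul_pos (hg : IsSemiRiemannianMetric I g) (hu : ContMDiff I 𝓘(ℝ, ℝ) 2 u)
    (hε : ε = 1 ∨ ε = -1) (hε' : ε' = 1 ∨ ε' = -1)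
    {ν : ∀ x : M, TangentSpace (I.prod 𝓘(ℝ, ℝ)) (graphMap u x)}
    (hν : IsUpwardUnitNormal I I (productMetric I g ε) (graphMap u) ε' ν) (x : M) :
    0 < ε' * (ε + g x (gradient I g u x) (gradient I g u x)) := by
  have h1 := normal_sign_eq hg hu hε hν x
  have hb := hν.upward x
  set b := dt I (graphMap u x) (ν x)
  set q := g x (gradient I g u x) (gradient I g u x)
  have hne : ε + q ≠ 0 := by
    intro h
    rw [h, mul_zero] at h1
    rcases hε' with h | h <;> rw [h] at h1 <;> norm_num at h1
  have h2 : ε' * (ε + q) = b ^ 2 * (ε + q) ^ 2 := by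
    linear_combination (ε + q) * h1
  rw [h2]
  positivity

variable [I.Boundaryless]

/-- The second fundamental form of a graph is `Hess u ⊗ ∂_t^⊥`. -/
lemma secondFundamentalForm_graphMap (hg : IsSemiRiemannianMetric I g)
    (hu : ContMDiff I 𝓘(ℝ, ℝ) 2 u) (hε : ε ≠ 0)
    (hF : IsSemiRiemannianImmersion I (I.prod 𝓘(ℝ, ℝ)) (productMetric I g ε) (graphMap u))
    (x₀ : M) (v w : E) :
    secondFundamentalForm I (I.prod 𝓘(ℝ, ℝ)) (productMetric I g ε) (graphMap u) x₀ v w =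
      hessian g u x₀ v w • normalPart I (I.prod 𝓘(ℝ, ℝ)) (productMetric I g ε) (graphMap u) x₀
        (partialT I (graphMap u x₀)) := by
  set Γ : E := coordChristoffel (localMetric I g x₀) (extChartAt I x₀ x₀) v w with hΓ
  have hud : MDifferentiableAt I 𝓘(ℝ, ℝ) u x₀ := hu.mdifferentiable (by norm_num) x₀
  have h1 : covDerivAlong I (I.prod 𝓘(ℝ, ℝ)) (productMetric I g ε) (graphMap u)
      (fun x ↦ mfderiv I (I.prod 𝓘(ℝ, ℝ)) (graphMap u) x
        (FiberBundle.extend E (x := x₀) (w : TangentSpace I x₀) x)) x₀ v =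
      mfderiv I (I.prod 𝓘(ℝ, ℝ)) (graphMap u) x₀ Γ +
        hessian g u x₀ v w • partialT I (graphMap u x₀) := by
    refine (covDerivAlong_graphMap hg hu hε x₀ v w).trans ?_
    refine Eq.symm ((congrArg₂ (fun a b : E × ℝ ↦ a + hessian g u x₀ v w • b)
      (mfderiv_graphMap hud Γ) (partialT_eq (graphMap u x₀))).trans ?_)
    rw [mvfderiv_eq_fderiv_chart_of_contMDiff hu x₀ Γ]
    simp [hessian, coordHessian, hΓ]
  refine (congrArg (normalPart I (I.prod 𝓘(ℝ, ℝ)) (productMetric I g ε) (graphMap u) x₀)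
    h1).trans ?_
  rw [normalPart_add, normalPart_smul]
  exact (congrArg (· + _) (normalPart_mfderiv hF x₀ Γ)).trans (zero_add _)

/-- The mean curvature vector of a graph is `W div(∇u / W) ∂_t^⊥`. -/
lemma meanCurvatureVector_graphMap (hg : IsSemiRiemannianMetric I g)
    (hu : ContMDiff I 𝓘(ℝ, ℝ) 2 u) (hε : ε = 1 ∨ ε = -1)
    (hF : IsSemiRiemannianImmersion I (I.prod 𝓘(ℝ, ℝ)) (productMetric I g ε) (graphMap u))
    (x : M) (hpos : 0 < ε' * (ε + g x (gradient I g u x) (gradient I g u x))) :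
    meanCurvatureVector I (I.prod 𝓘(ℝ, ℝ)) (productMetric I g ε) (graphMap u) x =
      (graphW I g ε ε' u x *
        divergence I g (fun x ↦ (1 / graphW I g ε ε' u x) • gradient I g u x) x) •
      normalPart I (I.prod 𝓘(ℝ, ℝ)) (productMetric I g ε) (graphMap u) x
        (partialT I (graphMap u x)) := by
  have hε0 : ε ≠ 0 := by rcases hε with rfl | rfl <;> norm_num
  have hW : graphW I g ε ε' u x ≠ 0 := (Real.sqrt_pos.mpr hpos).ne'
  have hud : MDifferentiableAt I 𝓘(ℝ, ℝ) u x := hu.mdifferentiable (by norm_num) x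
  obtain ⟨T, hT, hTb⟩ := exists_covDeriv_normalized_gradient hg hu hε x hpos
  let e : Module.Basis (Fin (Module.finrank ℝ E)) ℝ E := tangentBasis I x
  let γ : E →L[ℝ] E →L[ℝ] ℝ := pullback I (I.prod 𝓘(ℝ, ℝ)) (productMetric I g ε) (graphMap u) x
  have hγ : ∀ v w : E, γ v w = (g x : E →L[ℝ] E →L[ℝ] ℝ) v w +
      ε * (mvfderiv I u x v * mvfderiv I u x w) := pullback_productMetric_graphMap g ε hud
  have hγsymm : ∀ v w, γ v w = γ w v := fun v w ↦ by
    rw [hγ, hγ, mul_comm (mvfderiv I u x v)]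
    exact congrArg (· + _) (hg.symm x v w)
  have htr := sum_inv_gram_eq_trace e hγsymm (hF.nondegenerate x) (b := hessian g u x) (T := T)
    fun v w ↦ (hγ _ _).trans (hTb v w)
  have hdiv : divergence I g (fun x ↦ (1 / graphW I g ε ε' u x) • gradient I g u x) x =
      (1 / graphW I g ε ε' u x) * ∑ i, e.coord i (T (e i)) := by
    rw [Finset.mul_sum]
    refine Finset.sum_congr rfl fun i _ ↦ ?_
    exact (congrArg (e.coord i) (hT (e i))).trans (map_smul (e.coord i) _ _)
  rw [hdiv, ← mul_assoc, mul_one_div_cancel hW, one_mul, ← htr, Finset.sum_smul]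
  refine Finset.sum_congr rfl fun i _ ↦ ?_
  rw [Finset.sum_smul]
  refine Finset.sum_congr rfl fun j _ ↦ ?_
  rw [mul_smul]
  exact congrArg (_ • ·) (secondFundamentalForm_graphMap hg hu hε0 hF x (e i) (e j))

end Soliton

end SemiRiemann

open SemiRiemann in
theorem mainTheorem1
    {E : Type*} [NormedAddCommGroup E] [NormedSpace ℝ E] [FiniteDimensional ℝ E]
    {H : Type*} [TopologicalSpace H] (I : ModelWithCorners ℝ E H) [I.Boundaryless]
    {M : Type*} [TopologicalSpace M] [ChartedSpace H M] [IsManifold I ∞ M]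
    (g : FormField I M) (hg : IsSemiRiemannianMetric I g)
    (u : M → ℝ) (hu : ContMDiff I 𝓘(ℝ, ℝ) 2 u)
    (ε ε' : ℝ) (hε : ε = 1 ∨ ε = -1) (hε' : ε' = 1 ∨ ε' = -1)
    (hF : IsSemiRiemannianImmersion I (I.prod 𝓘(ℝ, ℝ)) (productMetric I g ε) (graphMap u))
    (ν : ∀ x : M, TangentSpace (I.prod 𝓘(ℝ, ℝ)) (graphMap u x))
    (hν : IsUpwardUnitNormal I I (productMetric I g ε) (graphMap u) ε' ν) :
    (∀ x : M, 0 < ε' * (ε + g x (gradient I g u x) (gradient I g u x))) ∧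
    (IsTranslatingSoliton I I (productMetric I g ε) (graphMap u) ↔
      ∀ x : M, divergence I g (fun x ↦ (1 / graphW I g ε ε' u x) • gradient I g u x) x =
        1 / graphW I g ε ε' u x) := by
  have hpos := normal_sign_mul_pos hg hu hε hε' hν
  have hε0 : ε ≠ 0 := by rcases hε with rfl | rfl <;> norm_num
  refine ⟨hpos, ?_⟩
  have hiff : ∀ x : M, meanCurvatureVector I (I.prod 𝓘(ℝ, ℝ)) (productMetric I g ε)
        (graphMap u) x = normalPart I (I.prod 𝓘(ℝ, ℝ)) (productMetric I g ε) (graphMap u) x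
          (partialT I (graphMap u x)) ↔
      divergence I g (fun x ↦ (1 / graphW I g ε ε' u x) • gradient I g u x) x =
        1 / graphW I g ε ε' u x := by
    intro x
    have hW : graphW I g ε ε' u x ≠ 0 := (Real.sqrt_pos.mpr (hpos x)).ne'
    have hT : normalPart I (I.prod 𝓘(ℝ, ℝ)) (productMetric I g ε) (graphMap u) x
      (partialT I (graphMap u x)) ≠ 0 := normalPart_partialT_ne_zero hε0 hν x
    rw [meanCurvatureVector_graphMap (ε' := ε') hg hu hε hF x (hpos x), eq_div_iff hW, mul_comm]
    constructor
    · intro h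
      refine smul_left_injective ℝ hT ?_
      simpa using h
    · intro h
      rw [h, one_smul]
  exact ⟨fun h x ↦ (hiff x).mp (h.meanCurvatureVector_eq x),
    fun h ↦ ⟨hF, fun x ↦ (hiff x).mpr (h x)⟩⟩
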